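/- Let $n\ge 2$ and $d\geq 2$ be integers. For a field $K$ let $K\langle X\rangle_d$ be the free associative $K$-algebra without unit on $d$ letters, i.e. the $K$-vector space with basis the nonempty words in $x_1,\dots,x_d$, multiplied by concatenation. Let $$N_{n,d}^{K}=K\langle X\rangle_d/\mathrm{id}\{x^n \mid x\in K\langle X\rangle_d\}$$ be its quotient by the two-sided ideal of the $K$-algebra $K\langle X\rangle_d$ generated by all $n$-th powers of its elements, and let $$C_{n,d}^{K}=\min\{c>0 \mid a_1\cdots a_c=0 \text{ for all } a_1,\dots,a_c\in N_{n,d}^{K}\}$$ be its nilpotency degree. Let $F$ be a finite field with exactly $n-1$ elements, and let $L$ be an infinite field with $\operatorname{char} L=\operatorname{char} F$. Then the algebras $N_{n,d}^{F}$ and $N_{n,d}^{L}$ are nilpotent, so that $C_{n,d}^{F}$ and $C_{n,d}^{L}$ are defined, and $$C_{n,d}^{L}\leq C_{n,d}^{F}\leq C_{n,d}^{L}+1 .$$ -/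

import Mathlib

universe u v

namespace NilAlg

/-- The product `a₁ a₂ ⋯ a_c` of a nonempty sequence with first entry `a` and remaining entries
`l` (so that `c = l.length + 1`), in an object without a unit. -/
def listProd {M : Type u} [Mul M] (a : M) (l : List M) : M :=
  l.foldl (fun x y => x * y) a

/-- The power `x ^ n` for `n ≥ 1`, in an object without a unit
(the value at `n = 0` has no meaning). -/
def power {M : Type u} [Mul M] (x : M) (n : ℕ) : M :=
  listProd x (List.replicate (n - 1) x)

/-- The free associative algebra without unit on `d` letters: the vector space over `F` whose basis
is the free semigroup (without unit) on `d` letters, with the multiplication that extends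
concatenation of words bilinearly. -/
abbrev FreeAlg (F : Type u) [Field F] (d : ℕ) : Type u :=
  MonoidAlgebra F (FreeSemigroup (Fin d))

/-- A linear subspace of the free algebra is a (two-sided) ideal if it is closed under
multiplication by arbitrary elements from the left and from the right. -/
def IsIdeal {F : Type u} [Field F] {d : ℕ} (I : Submodule F (FreeAlg F d)) : Prop :=
  ∀ a f : FreeAlg F d, f ∈ I → a * f ∈ I ∧ f * a ∈ I

/-- The ideal of the `F`-algebra `FreeAlg F d` generated by all `n`-th powers `x ^ n`, as a
subspace: the smallest subspace that is a two-sided ideal and contains all `x ^ n`. -/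
noncomputable def relationSpace (F : Type u) [Field F] (n d : ℕ) : Submodule F (FreeAlg F d) :=
  sInf {I | IsIdeal I ∧ ∀ x : FreeAlg F d, power x n ∈ I}

theorem isIdeal_relationSpace (F : Type u) [Field F] (n d : ℕ) :
    IsIdeal (relationSpace F n d) := by
  intro a f hf
  unfold relationSpace at hf ⊢
  rw [Submodule.mem_sInf] at hf
  constructor
  · rw [Submodule.mem_sInf]
    exact fun I hI => (hI.1 a f (hf I hI)).1
  · rw [Submodule.mem_sInf]
    exact fun I hI => (hI.1 a f (hf I hI)).2

/-- The same ideal, as a two-sided ideal of the ring. -/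
noncomputable def relationIdeal (F : Type u) [Field F] (n d : ℕ) : TwoSidedIdeal (FreeAlg F d) :=
  TwoSidedIdeal.mk' (relationSpace F n d : Set (FreeAlg F d))
    (relationSpace F n d).zero_mem
    (fun hx hy => (relationSpace F n d).add_mem hx hy)
    (fun hx => (relationSpace F n d).neg_mem hx)
    (fun {x y} hy => (isIdeal_relationSpace F n d x y hy).1)
    (fun {x y} hx => (isIdeal_relationSpace F n d y x hx).2)

/-- The relatively free algebra `N_{n,d}` with the identity `x ^ n = 0`: the quotient of the free
algebra without unit on `d` letters by the ideal generated by all `n`-th powers. -/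
abbrev N (F : Type u) [Field F] (n d : ℕ) : Type u :=
  (relationIdeal F n d).ringCon.Quotient

/-- The set of all `c > 0` such that `a₁ ⋯ a_c = 0` for all `a₁, …, a_c` in `N_{n,d}`. -/
def nilpotencySet (F : Type u) [Field F] (n d : ℕ) : Set ℕ :=
  {c | 0 < c ∧ ∀ (a : N F n d) (l : List (N F n d)), l.length + 1 = c → listProd a l = 0}

/-- The nilpotency degree `C_{n,d}` of `N_{n,d}`: the least element of `nilpotencySet F n d`. -/
noncomputable def C (F : Type u) [Field F] (n d : ℕ) : ℕ :=
  sInf (nilpotencySet F n d)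

end NilAlg

/-!
Let `q = n - 1 = |F|`. For elements `a i` of an algebra over a field, expand
`(∑ i, t i • a i) ^ n` in the scalars `t i`; the coefficient of `t ^ α` is a sum of words with
integer coefficients (`polarization`). If all polarizations vanish in an algebra over the prime
field, then every extension of scalars of that algebra satisfies `x ^ n = 0` as well, and so
receives a homomorphism from the relatively free algebra over the larger field
(`lift_mul_eq_zero`).

Over the infinite field `L` all polarizations vanish in `N`, as a polynomial that vanishes at all
points is zero. Hence a word that is zero in `N` over `F` is zero in `N` over `L`, which gives the
first inequality.

Over `F` only exponents modulo `q - 1` can be separated. Since the polarizations have total degree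
`q + 1`, the only ones that may survive are those of multidegree `(q, 1)`, namely
`P a b = ∑ a ^ i * b * a ^ j` over `i + j = q` (`insertSum a b q`), and they satisfy
`P a b = -P b a`. So `P` is bilinear and alternating. The relations in multidegree `(q - 1, 1, 1)`
give `P x (y * z) = y * P x z = P x y * z`, which is therefore alternating in `x`, `y`, `z`.
Finally `P (y * z) x = 0`: this comes from comparing `(1 - y) * (1 - z) = 1 - (y + z - y * z)`
with its inverse, a product of geometric series (`insertSum_mul_left_eq_zero`). Therefore
`P x y * z = P x (y * z) = 0`, and all polarizations over `F` are annihilated by multiplication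
with any further element. A word that is zero in `N` over `L` thus becomes zero in `N` over `F`
after multiplication by one more letter, which gives the second inequality.

That the nilpotency degrees exist is the theorem that a finitely generated nil algebra of bounded
index is nilpotent (`exists_forall_prod_map_eq_zero`), deduced here from Levitzki's lemma.
-/

namespace NilAlg

/-! ### Nilpotency of finitely generated nil algebras of bounded index -/

/-- **Levitzki's lemma.** A nonzero nil ideal of bounded index has a nonzero element `b` with
`b * r * b = 0` for all `r` in the ideal. Take the least `k` with `(a * x) ^ k * a = 0` for all
`x` and `b = (a * x) ^ (k - 1) * a ≠ 0`. Replacing `x` by `x + r * (a * x) ^ (k - 1)` gives an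
equation `b * r * b = -v * (b * r * b)` with `v` in the ideal, hence nilpotent. -/
theorem exists_ne_zero_forall_mul_mul_eq_zero {U : Type*} [Ring U] (B : Ideal U) [B.IsTwoSided]
    {n : ℕ} (hB : ∀ x ∈ B, x ^ n = 0) {a : U} (ha : a ∈ B) (ha0 : a ≠ 0) :
    ∃ b ∈ B, b ≠ 0 ∧ ∀ r ∈ B, b * r * b = 0 := by
  classical
  have hex : ∃ k, ∀ x ∈ B, (a * x) ^ k * a = 0 :=
    ⟨n, fun x hx => by rw [hB _ (B.mul_mem_left a hx), zero_mul]⟩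
  obtain ⟨k, hk⟩ : ∃ k, Nat.find hex = k + 1 := by
    refine Nat.exists_eq_succ_of_ne_zero fun h0 => ha0 ?_
    simpa using (Nat.find_eq_zero hex).1 h0 0 B.zero_mem
  have hspec : ∀ x ∈ B, (a * x) ^ (k + 1) * a = 0 := hk ▸ Nat.find_spec hex
  have hmin := Nat.find_min hex (m := k) (by omega)
  push Not at hmin
  obtain ⟨x, hx, hb⟩ := hmin
  refine ⟨(a * x) ^ k * a, B.mul_mem_left _ ha, hb, fun r hr => ?_⟩
  set b := (a * x) ^ k * a with hbdef
  set X := a * x with hX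
  set Y := a * (r * X ^ k) with hY
  have hYa : Y * a = a * r * b := by simp only [hY, hbdef, mul_assoc]
  have hYX : Y * X * a = 0 := by
    rw [hY, mul_assoc, mul_assoc, mul_assoc, ← mul_assoc (X ^ k), ← pow_succ, hspec x hx]
    simp
  have hr' : r * X ^ k ∈ B := B.mul_mem_right _ hr
  have hXY : X + Y = a * (x + r * X ^ k) := by rw [mul_add]
  clear_value Y
  have hfac : ∀ m, ∃ s, (X + Y) ^ m * a = a * s := by
    intro m
    induction m with
    | zero => exact ⟨1, by simp⟩
    | succ m ih =>
      refine ⟨(x + r * X ^ k) * ((X + Y) ^ m * a), ?_⟩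
      rw [pow_succ', mul_assoc, ← mul_assoc a, ← hXY]
  -- `Y * X` kills everything that starts with `a`, so only the products `X ^ i * Y ^ j * a` survive
  have hYS : ∀ m, Y * ((X + Y) ^ m * a) = Y ^ (m + 1) * a := by
    intro m
    induction m with
    | zero => simp
    | succ m ih =>
      obtain ⟨s, hs⟩ := hfac m
      rw [pow_succ', mul_assoc, add_mul, mul_add, ih, hs, ← mul_assoc X, ← mul_assoc Y,
        ← mul_assoc Y, hYX, zero_mul, zero_add, pow_succ' Y (m + 1), mul_assoc]
  have hS : ∀ m, ∃ v ∈ B, (X + Y) ^ (m + 1) * a =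
      X ^ (m + 1) * a + X ^ m * (Y * a) + v * (b * r * b) := by
    intro m
    induction m with
    | zero => exact ⟨0, B.zero_mem, by simp [add_mul]⟩
    | succ m ih =>
      obtain ⟨v, hv, h⟩ := ih
      refine ⟨X * v + Y ^ m * (a * r),
        B.add_mem (B.mul_mem_left _ hv) (B.mul_mem_left _ (B.mul_mem_left _ hr)), ?_⟩
      have h2 : Y ^ (m + 1 + 1) * a = Y ^ m * (a * r) * (b * r * b) := by
        rw [pow_succ, mul_assoc, hYa, pow_succ, mul_assoc, ← mul_assoc Y, ← mul_assoc Y, hYa]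
        simp only [mul_assoc]
      rw [pow_succ', mul_assoc, add_mul X Y, hYS, h2, h, pow_succ' X (m + 1), pow_succ' X m]
      noncomm_ring
  obtain ⟨v, hv, h⟩ := hS k
  have hbr : X ^ k * (Y * a) = b * r * b := by rw [hYa, hbdef]; simp only [mul_assoc]
  rw [hXY, hspec _ (B.add_mem hx hr'), hspec x hx, hbr, zero_add] at h
  have h1 : b * r * b = (-v) * (b * r * b) := by
    rw [neg_mul]; exact eq_neg_of_add_eq_zero_left h.symm
  have h2 : ∀ m, b * r * b = (-v) ^ m * (b * r * b) := by
    intro m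
    induction m with
    | zero => simp
    | succ m ih => rw [pow_succ, mul_assoc (_ ^ m), ← h1, ← ih]
  rw [h2 n, hB _ (B.neg_mem hv), zero_mul]

/-- Finitely many elements of a nil ideal of bounded index generate a nilpotent ring. Otherwise
there is a maximal two-sided ideal `I` that contains, for no `c`, all words of length `c`;
Levitzki's lemma modulo `I` yields two larger ideals whose product lies in `I`. -/
theorem exists_forall_prod_map_eq_zero {U : Type*} [Ring U] (B : Ideal U) [B.IsTwoSided]
    {n : ℕ} (hB : ∀ x ∈ B, x ^ n = 0) {σ : Type*} [Finite σ] (e : σ → U) (he : ∀ i, e i ∈ B) :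
    ∃ c, ∀ l : List σ, l.length = c → (l.map e).prod = 0 := by
  classical
  by_contra! hcon
  -- ideals that contain, for no `c`, all words of length `c`
  let S : Set (Ideal U) := {I | I.IsTwoSided ∧ ∀ c, ∃ l : List σ, l.length = c ∧ (l.map e).prod ∉ I}
  have hbot : (⊥ : Ideal U) ∈ S := ⟨inferInstance, fun c => by
    obtain ⟨l, hl, h⟩ := hcon c
    exact ⟨l, hl, by simpa using h⟩⟩
  obtain ⟨I, -, hI⟩ := zorn_le_nonempty₀ S (by
    intro c hcS hc J hJ
    have hdir := hc.directedOn
    refine ⟨sSup c, ⟨⟨fun b hx => ?_⟩, fun m => ?_⟩, fun J hJ => le_sSup hJ⟩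
    · obtain ⟨K, hK, hxK⟩ := (Submodule.mem_sSup_of_directed ⟨J, hJ⟩ hdir).1 hx
      have := (hcS hK).1
      exact le_sSup hK (Ideal.mul_mem_right _ K hxK)
    · by_contra! hall
      have hfin : {l : List σ | l.length = m}.Finite := List.finite_length_eq σ m
      have : ∀ l ∈ {l : List σ | l.length = m}, ∃ K ∈ c, (l.map e).prod ∈ K := fun l hl =>
        (Submodule.mem_sSup_of_directed ⟨J, hJ⟩ hdir).1 (hall l hl)
      have key : ∀ s : Set (List σ), s.Finite → (∀ l ∈ s, l.length = m) →
          ∃ K ∈ c, ∀ l ∈ s, (l.map e).prod ∈ K := by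
        intro s hs
        induction s, hs using Set.Finite.induction_on with
        | empty => exact fun _ => ⟨J, hJ, by simp⟩
        | @insert l s _ _ ih =>
          intro hl
          obtain ⟨K, hK, hKs⟩ := ih fun l' hl' => hl l' (Set.mem_insert_of_mem _ hl')
          obtain ⟨K', hK', hl'⟩ := this l (hl l (Set.mem_insert _ _))
          obtain ⟨K'', hK'', h1, h2⟩ := hdir K hK K' hK'
          refine ⟨K'', hK'', fun l'' hl'' => ?_⟩
          rcases Set.mem_insert_iff.1 hl'' with rfl | h
          · exact h2 hl'
          · exact h1 (hKs _ h)
      obtain ⟨K, hK, hKs⟩ := key _ hfin fun l hl => hl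
      obtain ⟨l, hl, hlK⟩ := (hcS hK).2 m
      exact hlK (hKs l hl)) ⊥ hbot
  have hIt : I.IsTwoSided := hI.prop.1
  -- an ideal strictly above `I` contains all words of some length
  have hmax : ∀ J : Ideal U, J.IsTwoSided → I ≤ J → (∃ b ∈ J, b ∉ I) →
      ∃ c, ∀ l : List σ, l.length = c → (l.map e).prod ∈ J := by
    intro J hJ hIJ ⟨b, hbJ, hbI⟩
    by_contra! h
    exact hbI (hI.le_of_ge ⟨hJ, fun c => h c⟩ hIJ hbJ)
  obtain ⟨b, hbB, hbI, hb⟩ : ∃ b ∈ B, b ∉ I ∧ ∀ r ∈ B, b * r * b ∈ I := by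
    obtain ⟨l, hl, hlI⟩ := hI.prop.2 1
    obtain ⟨i, rfl⟩ := List.length_eq_one_iff.1 hl
    have hB' : ∀ x ∈ B.map (Ideal.Quotient.mk I), x ^ n = 0 := by
      intro x hx
      obtain ⟨y, hy, rfl⟩ := (Ideal.mem_map_iff_of_surjective _ Ideal.Quotient.mk_surjective).1 hx
      rw [← map_pow, hB y hy, map_zero]
    have : (B.map (Ideal.Quotient.mk I)).IsTwoSided :=
      ⟨fun u hx => by
        obtain ⟨y, hy, rfl⟩ := (Ideal.mem_map_iff_of_surjective _ Ideal.Quotient.mk_surjective).1 hx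
        obtain ⟨u, rfl⟩ := Ideal.Quotient.mk_surjective u
        rw [← map_mul]
        exact Ideal.mem_map_of_mem _ (B.mul_mem_right _ hy)⟩
    obtain ⟨b, hb, hb0, hbr⟩ := exists_ne_zero_forall_mul_mul_eq_zero _ hB'
      (Ideal.mem_map_of_mem _ (he i))
      (fun h => hlI (by simpa using Ideal.Quotient.eq_zero_iff_mem.1 h))
    obtain ⟨y, hy, rfl⟩ := (Ideal.mem_map_iff_of_surjective _ Ideal.Quotient.mk_surjective).1 hb
    refine ⟨y, hy, fun h => hb0 (Ideal.Quotient.eq_zero_iff_mem.2 h), fun r hr => ?_⟩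
    rw [← Ideal.Quotient.eq_zero_iff_mem, map_mul, map_mul]
    exact hbr _ (Ideal.mem_map_of_mem _ hr)
  let Jl : Ideal U :=
    { carrier := {x | ∀ r ∈ B, b * r * x ∈ I}
      add_mem' := fun hx hy r hr => by rw [mul_add]; exact I.add_mem (hx r hr) (hy r hr)
      zero_mem' := fun r hr => by simp
      smul_mem' := fun u x hx r hr => by
        rw [smul_eq_mul, ← mul_assoc, mul_assoc b]
        exact hx _ (B.mul_mem_right _ hr) }
  have hJl : Jl.IsTwoSided := ⟨fun u hx r hr => by
    rw [← mul_assoc]; exact I.mul_mem_right _ (hx r hr)⟩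
  let Jr : Ideal U :=
    { carrier := {x | ∀ r ∈ B, ∀ y ∈ Jl, x * r * y ∈ I}
      add_mem' := fun hx hy r hr z hz => by
        rw [add_mul, add_mul]; exact I.add_mem (hx r hr z hz) (hy r hr z hz)
      zero_mem' := fun r hr y hy => by simp
      smul_mem' := fun u x hx r hr y hy => by
        rw [smul_eq_mul, mul_assoc, mul_assoc, ← mul_assoc x]
        exact I.mul_mem_left _ (hx r hr y hy) }
  have hJr : Jr.IsTwoSided := ⟨fun u hx r hr y hy => by
    rw [mul_assoc _ u]; exact hx _ (B.mul_mem_left _ hr) y hy⟩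
  obtain ⟨c, hc⟩ := hmax Jl hJl (fun x hx r _ => I.mul_mem_left _ hx) ⟨b, hb, hbI⟩
  obtain ⟨c', hc'⟩ := hmax Jr hJr
    (fun x hx r _ y _ => I.mul_mem_right _ (I.mul_mem_right _ hx))
    ⟨b, fun r hr y hy => hy r hr, hbI⟩
  obtain ⟨l, hl, hlI⟩ := hI.prop.2 (c' + (1 + c))
  refine hlI ?_
  obtain ⟨l₁, l₂, rfl, h₁, h₂⟩ : ∃ l₁ l₂, l = l₁ ++ l₂ ∧ l₁.length = c' ∧ l₂.length = 1 + c :=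
    ⟨l.take c', l.drop c', (List.take_append_drop _ _).symm, by simp [hl], by simp [hl]⟩
  match l₂, h₂ with
  | [], h₂ => simp at h₂; omega
  | i :: l₂, h₂ =>
    rw [List.map_append, List.prod_append, List.map_cons, List.prod_cons, ← mul_assoc]
    exact hc' l₁ h₁ _ (he i) _ (hc l₂ (by simp at h₂; omega))

/-! ### Sums of products with one or two inserted factors -/

section Sandwich

variable {U : Type*} [Ring U]

/-- The sum `∑ x ^ i * y * x ^ j` over all `i + j = m`. -/
def insertSum (x y : U) : ℕ → U
  | 0 => y
  | m + 1 => x * insertSum x y m + y * x ^ (m + 1)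

/-- The sum `∑ x ^ i * y * x ^ j * z * x ^ k` over all `i + j + k = m`. -/
def insertSum₂ (x y z : U) : ℕ → U
  | 0 => y * z
  | m + 1 => x * insertSum₂ x y z m + y * insertSum x z (m + 1)

theorem insertSum_succ (x y : U) (m : ℕ) :
    insertSum x y (m + 1) = x * insertSum x y m + y * x ^ (m + 1) := rfl

theorem insertSum₂_succ (x y z : U) (m : ℕ) :
    insertSum₂ x y z (m + 1) = x * insertSum₂ x y z m + y * insertSum x z (m + 1) := rfl

theorem insertSum_succ_right (x y : U) (m : ℕ) :
    insertSum x y (m + 1) = insertSum x y m * x + x ^ (m + 1) * y := by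
  induction m with
  | zero => simp [insertSum, add_comm]
  | succ m ih =>
    calc
      insertSum x y (m + 2) =
          x * (insertSum x y m * x + x ^ (m + 1) * y) + y * (x ^ (m + 1) * x) := by
        rw [insertSum_succ, ih, ← pow_succ]
      _ = (x * insertSum x y m + y * x ^ (m + 1)) * x + x * x ^ (m + 1) * y := by noncomm_ring
      _ = insertSum x y (m + 1) * x + x ^ (m + 2) * y := by rw [← insertSum_succ, ← pow_succ']

theorem insertSum₂_succ_right (x y z : U) (m : ℕ) :
    insertSum₂ x y z (m + 1) = insertSum₂ x y z m * x + insertSum x y (m + 1) * z := by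
  induction m with
  | zero => simp only [insertSum₂, insertSum]; noncomm_ring
  | succ m ih =>
    calc
      insertSum₂ x y z (m + 2) =
          x * (insertSum₂ x y z m * x + insertSum x y (m + 1) * z) +
            y * (insertSum x z (m + 1) * x + x ^ (m + 2) * z) := by
        rw [insertSum₂_succ, ih, insertSum_succ_right x z (m + 1)]
      _ = (x * insertSum₂ x y z m + y * insertSum x z (m + 1)) * x +
            (x * insertSum x y (m + 1) + y * x ^ (m + 2)) * z := by noncomm_ring
      _ = insertSum₂ x y z (m + 1) * x + insertSum x y (m + 2) * z := by
        rw [← insertSum₂_succ, ← insertSum_succ]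

theorem map_insertSum {V : Type*} [Ring V] (f : U →+* V) (x y : U) (m : ℕ) :
    f (insertSum x y m) = insertSum (f x) (f y) m := by
  induction m with
  | zero => rfl
  | succ m ih => simp [insertSum, ih]

theorem insertSum_add (x y z : U) (m : ℕ) :
    insertSum x (y + z) m = insertSum x y m + insertSum x z m := by
  induction m with
  | zero => rfl
  | succ m ih => simp only [insertSum, ih]; noncomm_ring

theorem insertSum_neg (x y : U) (m : ℕ) : insertSum x (-y) m = -insertSum x y m := by
  induction m with
  | zero => rfl
  | succ m ih => simp only [insertSum, ih]; noncomm_ring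

theorem insertSum_smul {F : Type*} [CommRing F] [Algebra F U] (t : F) (x y : U) (m : ℕ) :
    insertSum x (t • y) m = t • insertSum x y m := by
  induction m with
  | zero => rfl
  | succ m ih => simp [insertSum, ih]

theorem insertSum_self_mul (x y : U) (m : ℕ) :
    insertSum x (x * y) m = x * insertSum x y m := by
  induction m with
  | zero => rfl
  | succ m ih => simp only [insertSum, ih, mul_add, mul_assoc]

theorem insertSum_mul_self (x y : U) (m : ℕ) :
    insertSum x (y * x) m = insertSum x y m * x := by
  induction m with
  | zero => rfl
  | succ m ih =>
    simp only [insertSum, ih, add_mul, mul_assoc, pow_succ', ← pow_succ]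

theorem insertSum_self (x : U) (m : ℕ) : insertSum x x m = (m + 1 : ℕ) * x ^ (m + 1) := by
  induction m with
  | zero => simp [insertSum]
  | succ m ih =>
    rw [insertSum, ih, ← mul_assoc, (Nat.cast_commute _ x).symm.eq, mul_assoc, ← pow_succ',
      Nat.cast_succ (m + 1), add_one_mul]

theorem insertSum_self_eq_zero {x : U} {m : ℕ} (hx : x ^ (m + 1) = 0) : insertSum x x m = 0 := by
  rw [insertSum_self, hx, mul_zero]

theorem insertSum₂_sub_left (x y y' z : U) (m : ℕ) :
    insertSum₂ x (y - y') z m = insertSum₂ x y z m - insertSum₂ x y' z m := by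
  induction m with
  | zero => simp [insertSum₂, sub_mul]
  | succ m ih => simp only [insertSum₂, ih]; noncomm_ring

theorem insertSum₂_sub_right (x y z z' : U) (m : ℕ) :
    insertSum₂ x y (z - z') m = insertSum₂ x y z m - insertSum₂ x y z' m := by
  have h : ∀ k, insertSum x (z - z') k = insertSum x z k - insertSum x z' k := fun k => by
    rw [sub_eq_add_neg, insertSum_add, insertSum_neg, ← sub_eq_add_neg]
  induction m with
  | zero => simp [insertSum₂, mul_sub]
  | succ m ih => simp only [insertSum₂, ih, h]; noncomm_ring

theorem insertSum₂_self_mul_left (x y z : U) (m : ℕ) :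
    insertSum₂ x (x * y) z m = x * insertSum₂ x y z m := by
  induction m with
  | zero => simp [insertSum₂, mul_assoc]
  | succ m ih => simp only [insertSum₂, ih]; noncomm_ring

/-- Moving a factor `x` from the far left to the place before the second inserted factor changes
the sum only by its boundary terms. -/
theorem insertSum₂_self_mul_right (x y z : U) (m : ℕ) :
    insertSum₂ x y (x * z) m =
      x * insertSum₂ x y z m - insertSum x (y * z) (m + 1) + y * insertSum x z (m + 1) := by
  induction m with
  | zero => simp only [insertSum₂, insertSum]; noncomm_ring
  | succ m ih =>
    simp only [insertSum₂, ih, insertSum_self_mul]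
    rw [insertSum_succ x (y * z) (m + 1), insertSum_succ x z (m + 1)]
    noncomm_ring

theorem insertSum₂_mul_self_left (x y z : U) (m : ℕ) :
    insertSum₂ x (y * x) z m = insertSum₂ x y (x * z) m := by
  induction m with
  | zero => simp [insertSum₂, mul_assoc]
  | succ m ih => simp only [insertSum₂, ih, insertSum_self_mul, mul_assoc]

theorem insertSum₂_mul_self_right (x y z : U) (m : ℕ) :
    insertSum₂ x y (z * x) m = insertSum₂ x y z m * x := by
  induction m with
  | zero => simp [insertSum₂, mul_assoc]
  | succ m ih => simp only [insertSum₂, ih, insertSum_mul_self, mul_assoc, add_mul]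

/-- Shifting the factor `x` of `1 - x` to the neighbouring places makes the sum telescope, up to
sums with one inserted factor. -/
theorem sum_insertSum₂_one_sub_mul (x y z : U) (m : ℕ) :
    ∑ k ∈ Finset.range m, (insertSum₂ x ((1 - x) * y) z k + insertSum₂ x z ((1 - x) * y) k) =
      y * ∑ k ∈ Finset.range (m + 1), insertSum x z k +
        ∑ k ∈ Finset.range (m + 1), insertSum x (z * y) k -
        (insertSum₂ x y z m + insertSum₂ x z y m) := by
  induction m with
  | zero => simp [insertSum, insertSum₂]
  | succ m ih =>
    rw [Finset.sum_range_succ, ih, Finset.sum_range_succ _ (m + 1),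
      Finset.sum_range_succ _ (m + 1), one_sub_mul, insertSum₂_sub_left, insertSum₂_sub_right,
      insertSum₂_self_mul_left, insertSum₂_self_mul_right, insertSum₂_succ, insertSum₂_succ]
    noncomm_ring

theorem insertSum₂_zero_succ (y z : U) (m : ℕ) : insertSum₂ 0 y z (m + 1) = 0 := by
  simp [insertSum₂, insertSum]

/-- The product of `y` with two geometric series is the sum of all `x ^ i * y * x ^ j`, and the
terms with `i + j > q` add up to zero. -/
theorem geom_mul_mul_geom {x g : U} {q : ℕ} (hg : g * (1 - x) = 1)
    (hx : x ^ (q + 1) = 0) (y : U) (hy : x * insertSum x y q = 0) :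
    g * y * g = ∑ m ∈ Finset.range q, insertSum x y m + insertSum x y q := by
  have hgeom : g = ∑ m ∈ Finset.range (q + 1), x ^ m := by
    have h := mul_neg_geom_sum x (q + 1)
    rw [hx, sub_zero] at h
    rw [← mul_one g, ← h, ← mul_assoc, hg, one_mul]
  have key : ∀ m, (1 - x) * ∑ k ∈ Finset.range (m + 1), insertSum x y k =
      y * ∑ k ∈ Finset.range (m + 1), x ^ k - x * insertSum x y m := by
    intro m
    induction m with
    | zero => simp [insertSum, sub_mul]
    | succ m ih =>
      rw [Finset.sum_range_succ, mul_add, ih, Finset.sum_range_succ _ (m + 1), insertSum]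
      noncomm_ring
  rw [← Finset.sum_range_succ, ← one_mul (∑ m ∈ _, insertSum x y m), ← hg, mul_assoc g (1 - x), key,
    hy, sub_zero, ← hgeom, mul_assoc]

end Sandwich

section Polynomial

open Polynomial

variable {U : Type*} [Ring U]

theorem coeff_succ_linear_mul (a b : U) (p : U[X]) (k : ℕ) :
    ((Polynomial.C a + X * Polynomial.C b) * p).coeff (k + 1) =
      a * p.coeff (k + 1) + b * p.coeff k := by
  rw [add_mul, coeff_add, coeff_C_mul, mul_assoc, coeff_X_mul, coeff_C_mul]

theorem coeff_zero_linear_mul (a b : U) (p : U[X]) :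
    ((Polynomial.C a + X * Polynomial.C b) * p).coeff 0 = a * p.coeff 0 := by
  simp [mul_coeff_zero]

theorem coeff_zero_linear_pow (a b : U) (m : ℕ) :
    ((Polynomial.C a + X * Polynomial.C b) ^ m).coeff 0 = a ^ m := by
  induction m with
  | zero => simp
  | succ m ih => rw [pow_succ', coeff_zero_linear_mul, ih, pow_succ']

theorem coeff_one_linear_pow (a b : U) (m : ℕ) :
    ((Polynomial.C a + X * Polynomial.C b) ^ (m + 1)).coeff 1 = insertSum a b m := by
  induction m with
  | zero => simp [insertSum]
  | succ m ih => rw [pow_succ', coeff_succ_linear_mul, ih, coeff_zero_linear_pow, insertSum]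

theorem natDegree_linear_le (a b : U) : (Polynomial.C a + X * Polynomial.C b).natDegree ≤ 1 := by
  refine natDegree_add_le_of_degree_le (by simp) ?_
  exact (natDegree_mul_C_le _ _).trans natDegree_X_le

theorem natDegree_linear_pow_le (a b : U) (m : ℕ) :
    ((Polynomial.C a + X * Polynomial.C b) ^ m).natDegree ≤ m := by
  simpa using natDegree_pow_le_of_le m (natDegree_linear_le a b)

theorem coeff_self_linear_pow (a b : U) (m : ℕ) :
    ((Polynomial.C a + X * Polynomial.C b) ^ m).coeff m = b ^ m := by
  induction m with
  | zero => simp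
  | succ m ih =>
    rw [pow_succ', coeff_succ_linear_mul, ih, coeff_eq_zero_of_natDegree_lt, mul_zero, zero_add,
      pow_succ']
    exact Nat.lt_succ_of_le (natDegree_linear_pow_le a b m)

theorem coeff_linear_pow_succ (a b : U) (m : ℕ) :
    ((Polynomial.C a + X * Polynomial.C b) ^ (m + 1)).coeff m = insertSum b a m := by
  induction m with
  | zero => simp [insertSum]
  | succ m ih =>
    rw [pow_succ', coeff_succ_linear_mul, ih, coeff_self_linear_pow, insertSum, add_comm]

theorem natDegree_insertSum_le (a b x : U) (m : ℕ) :
    (insertSum (Polynomial.C a + X * Polynomial.C b) (Polynomial.C x) m).natDegree ≤ m := by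
  induction m with
  | zero => simp [insertSum]
  | succ m ih =>
    refine natDegree_add_le_of_degree_le ?_ ?_
    · exact (natDegree_mul_le_of_le (natDegree_linear_le a b) ih).trans (by omega)
    · exact (natDegree_C_mul_le _ _).trans (natDegree_linear_pow_le a b _)

theorem coeff_zero_insertSum (a b x : U) (m : ℕ) :
    (insertSum (Polynomial.C a + X * Polynomial.C b) (Polynomial.C x) m).coeff 0 =
      insertSum a x m := by
  induction m with
  | zero => simp [insertSum]
  | succ m ih =>
    rw [insertSum, coeff_add, coeff_zero_linear_mul, ih, coeff_C_mul, coeff_zero_linear_pow,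
      insertSum]

theorem coeff_one_insertSum (a b x : U) (m : ℕ) :
    (insertSum (Polynomial.C a + X * Polynomial.C b) (Polynomial.C x) (m + 1)).coeff 1 =
      insertSum₂ a b x m + insertSum₂ a x b m := by
  induction m with
  | zero =>
    simp only [insertSum, insertSum₂]
    rw [coeff_add, coeff_succ_linear_mul, coeff_C_mul, coeff_one_linear_pow]
    simp [insertSum, coeff_C]
  | succ m ih =>
    rw [insertSum, coeff_add, coeff_succ_linear_mul, ih, coeff_C_mul, coeff_one_linear_pow,
      coeff_zero_insertSum, insertSum₂, insertSum₂]
    noncomm_ring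

theorem coeff_self_insertSum (a b x : U) (m : ℕ) :
    (insertSum (Polynomial.C a + X * Polynomial.C b) (Polynomial.C x) m).coeff m =
      insertSum b x m := by
  induction m with
  | zero => simp [insertSum]
  | succ m ih =>
    rw [insertSum, coeff_add, coeff_succ_linear_mul, ih, coeff_C_mul, coeff_self_linear_pow,
      coeff_eq_zero_of_natDegree_lt (Nat.lt_succ_of_le (natDegree_insertSum_le a b x m)), mul_zero,
      zero_add, insertSum]

variable {F : Type*} [Field F] [Algebra F U]

/-- Evaluation of a polynomial at a central scalar. -/
noncomputable def evalScalar (t : F) : U[X] →+* U :=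
  eval₂RingHom' (RingHom.id U) (algebraMap F U t) fun a => (Algebra.commutes t a).symm

theorem evalScalar_apply (t : F) (p : U[X]) :
    evalScalar t p = p.eval₂ (RingHom.id U) (algebraMap F U t) := rfl

@[simp] theorem evalScalar_C (t : F) (a : U) : evalScalar t (Polynomial.C a) = a := by
  simp [evalScalar_apply]

@[simp] theorem evalScalar_X (t : F) : evalScalar t (X : U[X]) = algebraMap F U t := by
  simp [evalScalar_apply]

theorem evalScalar_linear (t : F) (a b : U) :
    evalScalar t (Polynomial.C a + X * Polynomial.C b) = a + t • b := by
  rw [map_add, map_mul, evalScalar_C, evalScalar_C, evalScalar_X, Algebra.smul_def]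

variable [Fintype F]

/-- A polynomial of degree at most `q = |F|` that vanishes on `F` is a multiple of `X ^ q - X`. -/
theorem coeff_one_add_coeff_card_eq_zero {p : U[X]} (hp : p.natDegree ≤ Fintype.card F)
    (h : ∀ t : F, evalScalar t p = 0) : p.coeff 1 + p.coeff (Fintype.card F) = 0 := by
  classical
  set q := Fintype.card F with hq
  have hq1 : 1 < q := Fintype.one_lt_card
  rw [← Module.forall_dual_apply_eq_zero_iff F]
  intro φ
  set r : F[X] := ∑ k ∈ Finset.range q, monomial k (φ (p.coeff k)) +
    Polynomial.C (φ (p.coeff q)) * X with hr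
  have hcoeff : r.coeff 1 = φ (p.coeff 1) + φ (p.coeff q) := by
    simp [hr, coeff_monomial, hq1]
  have hr0 : r = 0 := by
    refine eq_zero_of_natDegree_lt_card_of_eval_eq_zero r (f := fun t : F => t) (fun _ _ h => h)
      (fun t => ?_) ?_
    · have := congrArg φ (h t)
      rw [map_zero] at this
      rw [← this]
      have : evalScalar t p = ∑ k ∈ Finset.range (q + 1), t ^ k • p.coeff k := by
        rw [evalScalar_apply, eval₂_eq_sum_range' _ (Nat.lt_succ_of_le hp)]
        refine Finset.sum_congr rfl fun k _ => ?_
        rw [Algebra.smul_def, map_pow, RingHom.id_apply, ← map_pow, Algebra.commutes]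
      rw [this, Finset.sum_range_succ]
      have ht : t ^ q = t := FiniteField.pow_card t
      simp only [hr, eval_add, eval_finsetSum, eval_monomial, eval_mul, eval_C, eval_X, map_add,
        map_sum, map_smul, smul_eq_mul, ht, mul_comm]
    · refine Nat.lt_of_le_of_lt (m := q - 1) ?_ (by omega)
      refine natDegree_add_le_of_degree_le ?_ ?_
      · refine natDegree_sum_le_of_forall_le _ _ fun k hk => (natDegree_monomial_le _).trans ?_
        have := Finset.mem_range.1 hk
        omega
      · exact (natDegree_C_mul_le _ _).trans (natDegree_X_le.trans (by omega))
  rw [map_add, ← hcoeff, hr0, coeff_zero]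

theorem coeff_one_eq_zero {p : U[X]} (hp : p.natDegree < Fintype.card F)
    (h : ∀ t : F, evalScalar t p = 0) : p.coeff 1 = 0 := by
  simpa [coeff_eq_zero_of_natDegree_lt hp] using coeff_one_add_coeff_card_eq_zero hp.le h

end Polynomial

/-! ### The exceptional component over a field with `n - 1` elements -/

section Exceptional

open Polynomial

variable {F : Type*} [Field F] [Fintype F] {U : Type*} [Ring U] [Algebra F U]
  {B : Ideal U}

/-- The map `P a b = ∑ a ^ i * b * a ^ j` (over `i + j = q`) is antisymmetric. The coefficients of
`t` and of `t ^ q` in `(a + t * b) ^ (q + 1) = 0` cannot be separated over `F`; they are `P a b`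
and `P b a`. -/
theorem insertSum_swap (hB : ∀ x ∈ B, x ^ (Fintype.card F + 1) = 0) {a b : U} (ha : a ∈ B)
    (hb : b ∈ B) :
    insertSum a b (Fintype.card F) = -insertSum b a (Fintype.card F) := by
  have hdeg : ((Polynomial.C a + X * Polynomial.C b) ^ (Fintype.card F + 1)).natDegree ≤
      Fintype.card F := by
    refine natDegree_le_iff_coeff_eq_zero.2 fun N hN => ?_
    rcases (Nat.succ_le_of_lt hN).eq_or_lt with rfl | h
    · rw [Nat.succ_eq_add_one, coeff_self_linear_pow, hB b hb]
    · exact coeff_eq_zero_of_natDegree_lt ((natDegree_linear_pow_le a b _).trans_lt h)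
  have h := coeff_one_add_coeff_card_eq_zero (F := F) hdeg fun t => by
    rw [map_pow, evalScalar_linear]
    exact hB _ (B.add_mem ha (B.smul_of_tower_mem t hb))
  rw [coeff_one_linear_pow, coeff_linear_pow_succ] at h
  exact eq_neg_of_add_eq_zero_left h

/-- `P a x` is additive in `a`, although it has degree `q` in `a`: swap the arguments. -/
theorem insertSum_add_left (hB : ∀ x ∈ B, x ^ (Fintype.card F + 1) = 0) {a b x : U} (ha : a ∈ B)
    (hb : b ∈ B) (hx : x ∈ B) :
    insertSum (a + b) x (Fintype.card F) =
      insertSum a x (Fintype.card F) + insertSum b x (Fintype.card F) := by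
  rw [insertSum_swap hB (B.add_mem ha hb) hx, insertSum_add, neg_add, ← insertSum_swap hB ha hx,
    ← insertSum_swap hB hb hx]

theorem insertSum_smul_left (hB : ∀ x ∈ B, x ^ (Fintype.card F + 1) = 0) {a x : U} (ha : a ∈ B)
    (hx : x ∈ B) (t : F) :
    insertSum (t • a) x (Fintype.card F) = t • insertSum a x (Fintype.card F) := by
  rw [insertSum_swap hB (B.smul_of_tower_mem t ha) hx, insertSum_smul, ← smul_neg,
    ← insertSum_swap hB ha hx]

/-- The component of multidegree `(q - 1, 1, 1)` of `(a + b + x) ^ (q + 1)` vanishes: it is the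
coefficient of `t` in `P (a + t * b) x - P a x - t * P b x`, and the coefficient of `t ^ q`, which
could interfere with it, is zero. -/
theorem insertSum₂_add_swap (hB : ∀ x ∈ B, x ^ (Fintype.card F + 1) = 0) {a b x : U}
    (ha : a ∈ B) (hb : b ∈ B) (hx : x ∈ B) {m : ℕ} (hm : m + 1 = Fintype.card F) :
    insertSum₂ a b x m + insertSum₂ a x b m = 0 := by
  have hq : 1 < Fintype.card F := Fintype.one_lt_card
  set q := Fintype.card F with hqdef
  have hdeg : (insertSum (Polynomial.C a + X * Polynomial.C b) (Polynomial.C x) q -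
      (Polynomial.C (insertSum a x q) + X * Polynomial.C (insertSum b x q))).natDegree ≤ q :=
    (natDegree_sub_le_of_le (natDegree_insertSum_le a b x q)
      ((natDegree_linear_le _ _).trans hq.le)).trans (max_self q).le
  have h := coeff_one_add_coeff_card_eq_zero (F := F) hdeg fun t => by
    have hbt := B.smul_of_tower_mem t hb
    rw [map_sub, map_insertSum, evalScalar_linear, evalScalar_linear, evalScalar_C,
      insertSum_add_left hB ha hbt hx, insertSum_smul_left hB hb hx, sub_self]
  rw [← hqdef, coeff_sub, coeff_sub, coeff_self_insertSum, coeff_add, coeff_X_mul, coeff_C_zero,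
    coeff_eq_zero_of_natDegree_lt ((natDegree_linear_le _ _).trans_lt hq), ← hm,
    coeff_one_insertSum, coeff_C_of_ne_zero one_ne_zero, hm] at h
  simpa using h

theorem insertSum_mul_eq_mul_insertSum (hB : ∀ x ∈ B, x ^ (Fintype.card F + 1) = 0) {x y z : U}
    (hx : x ∈ B) (hy : y ∈ B) (hz : z ∈ B) :
    insertSum x (y * z) (Fintype.card F) = y * insertSum x z (Fintype.card F) := by
  obtain ⟨m, hm⟩ := Nat.exists_eq_add_one.2 (Fintype.card_pos (α := F))
  have h1 := insertSum₂_add_swap hB hx hy hz hm.symm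
  have h2 := insertSum₂_add_swap hB hx (B.mul_mem_left x hz) hy hm.symm
  rw [insertSum₂_self_mul_left, insertSum₂_self_mul_right, ← hm] at h2
  have h3 := congrArg (x * ·) h1
  simp only [mul_add, mul_zero] at h3
  have h4 : x * insertSum₂ x y z m = -(x * insertSum₂ x z y m) := eq_neg_of_add_eq_zero_left h3
  rw [h4] at h2
  have h5 : y * insertSum x z (Fintype.card F) - insertSum x (y * z) (Fintype.card F) = 0 := by
    rw [← h2]; abel
  exact (sub_eq_zero.1 h5).symm

variable [B.IsTwoSided]

theorem insertSum_mul_eq_insertSum_mul (hB : ∀ x ∈ B, x ^ (Fintype.card F + 1) = 0) {x y z : U}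
    (hx : x ∈ B) (hy : y ∈ B) (hz : z ∈ B) :
    insertSum x (y * z) (Fintype.card F) = insertSum x y (Fintype.card F) * z := by
  obtain ⟨m, hm⟩ := Nat.exists_eq_add_one.2 (Fintype.card_pos (α := F))
  have h1 := insertSum₂_add_swap hB hx hy hz hm.symm
  have h2 := insertSum₂_add_swap hB hx (B.mul_mem_right x hy) hz hm.symm
  rw [insertSum₂_mul_self_left, insertSum₂_mul_self_right, insertSum₂_self_mul_right, ← hm,
    insertSum_mul_eq_mul_insertSum hB hx hy hz, sub_add_cancel,
    eq_neg_of_add_eq_zero_right h1, neg_mul, add_neg_eq_zero] at h2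
  have h3 := insertSum₂_succ_right x y z m
  rw [insertSum₂_succ, h2, ← hm] at h3
  rw [insertSum_mul_eq_mul_insertSum hB hx hy hz]
  exact add_left_cancel h3

/-- The trilinear map `y * P x z` is alternating, and it equals `P x y * z`. Hence `P x z`
anticommutes with `y`. -/
theorem mul_insertSum_add_insertSum_mul (hB : ∀ x ∈ B, x ^ (Fintype.card F + 1) = 0) {x y z : U}
    (hx : x ∈ B) (hy : y ∈ B) (hz : z ∈ B) :
    y * insertSum x z (Fintype.card F) + insertSum x z (Fintype.card F) * y = 0 := by
  have h1 : insertSum x z (Fintype.card F) * y = -(y * insertSum x z (Fintype.card F)) := by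
    rw [insertSum_swap hB hx hz, neg_mul, ← insertSum_mul_eq_insertSum_mul hB hz hx hy,
      insertSum_mul_eq_mul_insertSum hB hz hx hy, insertSum_swap hB hz hy, mul_neg,
      ← insertSum_mul_eq_mul_insertSum hB hy hx hz, insertSum_mul_eq_insertSum_mul hB hy hx hz,
      insertSum_swap hB hy hx, neg_mul, ← insertSum_mul_eq_insertSum_mul hB hx hy hz,
      insertSum_mul_eq_mul_insertSum hB hx hy hz, insertSum_swap hB hz hx, mul_neg, mul_neg,
      neg_neg]
  rw [h1, add_neg_cancel]

theorem mul_insertSum_self (hB : ∀ x ∈ B, x ^ (Fintype.card F + 1) = 0) {x y : U}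
    (hx : x ∈ B) (hy : y ∈ B) : x * insertSum x y (Fintype.card F) = 0 := by
  rw [← insertSum_mul_eq_mul_insertSum hB hx hx hy, insertSum_mul_eq_insertSum_mul hB hx hx hy,
    insertSum_self_eq_zero (hB x hx), zero_mul]

/-- `P (y * z) x = 0`. The inverse of `1 - (y + (1 - y) * z) = (1 - y) * (1 - z)` is a product of
two geometric series. Comparing the two-sided geometric series of `y + (1 - y) * z`, `y` and `z`
around `x` expresses `P y x - P (y * z) x` through terms of degree less than `q` in `z`. The
coefficient of `t` after replacing `z` by `t * z` is the multidegree `(q - 1, 1, 1)` component in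
`y, z, x`. -/
theorem insertSum_mul_left_eq_zero (hB : ∀ x ∈ B, x ^ (Fintype.card F + 1) = 0) {x y z : U}
    (hx : x ∈ B) (hy : y ∈ B) (hz : z ∈ B) : insertSum (y * z) x (Fintype.card F) = 0 := by
  have hq : 1 < Fintype.card F := Fintype.one_lt_card
  set q := Fintype.card F with hqdef
  obtain ⟨m, hm⟩ : ∃ m, q = m + 1 := Nat.exists_eq_add_one.2 (by omega)
  -- the inverses of `1 - a` for `a ∈ B`
  obtain ⟨g, hgl, hgr⟩ : ∃ g : U → U,
      (∀ a ∈ B, g a * (1 - a) = 1) ∧ ∀ a ∈ B, (1 - a) * g a = 1 :=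
    ⟨fun a => ∑ k ∈ Finset.range (q + 1), a ^ k,
      fun a ha => by rw [geom_sum_mul_neg, hB a ha, sub_zero],
      fun a ha => by rw [mul_neg_geom_sum, hB a ha, sub_zero]⟩
  have hgeom : ∀ a ∈ B, ∀ u ∈ B, g a * u * g a =
      ∑ k ∈ Finset.range q, insertSum a u k + insertSum a u q := fun a ha u hu =>
    geom_mul_mul_geom (hgl a ha) (hB a ha) u (mul_insertSum_self hB ha hu)
  have hGx : g y * x ∈ B := B.mul_mem_left _ hx
  -- `1 - (z + (1 - y) * z) = (1 - y) * (1 - z)`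
  have hP : ∀ z ∈ B, insertSum y x q - insertSum (y * z) x q =
      (∑ k ∈ Finset.range q, insertSum z (g y * x) k) * g y -
        ∑ k ∈ Finset.range q, insertSum (y + (1 - y) * z) x k := by
    intro z hz
    have hyz : y * z ∈ B := B.mul_mem_left _ hz
    have hz' : (1 - y) * z ∈ B := B.mul_mem_left _ hz
    have hw : y + (1 - y) * z ∈ B := B.add_mem hy hz'
    have hgw : g (y + (1 - y) * z) = g z * g y := by
      have h1 : 1 - (y + (1 - y) * z) = (1 - y) * (1 - z) := by noncomm_ring
      have h2 := hgl _ hw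
      rw [h1] at h2
      calc
        g (y + (1 - y) * z) = g (y + (1 - y) * z) * ((1 - y) * ((1 - z) * g z) * g y) := by
          rw [hgr z hz, mul_one, hgr y hy, mul_one]
        _ = g (y + (1 - y) * z) * ((1 - y) * (1 - z)) * (g z * g y) := by
          simp only [mul_assoc]
        _ = g z * g y := by rw [h2, one_mul]
    -- `P z x` anticommutes with `y` and is killed by `y ^ 2`, so the factors `g y` cancel
    have hc : g y * insertSum z x q * g y = insertSum z x q := by
      have h1 := mul_insertSum_add_insertSum_mul hB hz hy hx
      have h2 : y * (y * insertSum z x q) = 0 := by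
        rw [← insertSum_mul_eq_mul_insertSum hB hz hy hx,
          insertSum_mul_eq_insertSum_mul hB hz hy hx, insertSum_swap hB hz hy, neg_mul, mul_neg,
          ← mul_assoc, mul_insertSum_self hB hy hz, zero_mul, neg_zero]
      have h3 : (1 - y) * insertSum z x q * (1 - y) = insertSum z x q := by
        have : insertSum z x q * y = -(y * insertSum z x q) := eq_neg_of_add_eq_zero_right h1
        have h4 : (1 - y) * insertSum z x q * (1 - y) = insertSum z x q - y * insertSum z x q -
            insertSum z x q * y + y * (insertSum z x q * y) := by noncomm_ring
        rw [h4, this, mul_neg, h2]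
        abel
      calc
        g y * insertSum z x q * g y =
            g y * ((1 - y) * insertSum z x q * (1 - y)) * g y := by rw [h3]
        _ = g y * (1 - y) * insertSum z x q * ((1 - y) * g y) := by simp only [mul_assoc]
        _ = insertSum z x q := by rw [hgl y hy, hgr y hy, one_mul, mul_one]
    have hPG : insertSum z (g y * x) q = g y * insertSum z x q := by
      have h1 : g y * x = x + y * (g y * x) := by
        have := hgr y hy
        rw [sub_mul, one_mul, sub_eq_iff_eq_add] at this
        rw [← mul_assoc, ← one_add_mul, ← this]
      have h2 := insertSum_mul_eq_mul_insertSum hB hz hy hGx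
      have h3 : (1 - y) * insertSum z (g y * x) q = insertSum z x q := by
        rw [one_sub_mul, ← h2, sub_eq_iff_eq_add, ← insertSum_add, ← h1]
      rw [← h3, ← mul_assoc, hgl y hy, one_mul]
    have h1 := hgeom _ hw x hx
    have h2 : g (y + (1 - y) * z) * x * g (y + (1 - y) * z) = g z * (g y * x) * g z * g y := by
      rw [hgw]; simp only [mul_assoc]
    have h3 : insertSum z x q = insertSum ((1 - y) * z) x q + insertSum (y * z) x q := by
      rw [← insertSum_add_left hB hz' hyz hx, one_sub_mul, sub_add_cancel]
    rw [h2, hgeom z hz _ hGx, add_mul, hPG, hc, insertSum_add_left hB hy hz' hx, h3] at h1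
    rw [← sub_eq_zero, ← neg_eq_zero] at h1
    rw [← sub_eq_zero]
    refine Eq.trans ?_ h1
    simp only [← hqdef]
    abel
  -- both sides are polynomials in `z` of degree less than `q`
  set p : U[X] := Polynomial.C (insertSum y x q) + X * Polynomial.C (-insertSum (y * z) x q) -
    ((∑ k ∈ Finset.range q, insertSum (Polynomial.C 0 + X * Polynomial.C z)
        (Polynomial.C (g y * x)) k) * Polynomial.C (g y) -
      ∑ k ∈ Finset.range q, insertSum (Polynomial.C y + X * Polynomial.C ((1 - y) * z))
        (Polynomial.C x) k) with hp
  have hdeg : p.natDegree ≤ m := by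
    have hsum : ∀ a b u : U, (∑ k ∈ Finset.range q,
        insertSum (Polynomial.C a + X * Polynomial.C b) (Polynomial.C u) k).natDegree ≤ m :=
      fun a b u => natDegree_sum_le_of_forall_le _ _ fun k hk =>
        (natDegree_insertSum_le a b u k).trans (by have := Finset.mem_range.1 hk; omega)
    refine (natDegree_sub_le_of_le ((natDegree_linear_le _ _).trans (by omega : 1 ≤ m))
      ((natDegree_sub_le_of_le ((natDegree_mul_C_le _ _).trans (hsum _ _ _))
        (hsum _ _ _)).trans (max_self m).le)).trans (max_self m).le
  have hcoeff : p.coeff 1 = 0 := by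
    refine coeff_one_eq_zero (F := F) (by omega) fun t => ?_
    have h := hP (t • z) (B.smul_of_tower_mem t hz)
    rw [mul_smul_comm, mul_smul_comm,
      insertSum_smul_left hB (B.mul_mem_left _ hz) hx, sub_eq_add_neg] at h
    rw [hp, map_sub, map_sub, map_mul, map_sum, map_sum, evalScalar_linear, smul_neg, h,
      evalScalar_C, sub_eq_zero]
    simp only [map_insertSum, evalScalar_linear, evalScalar_C, zero_add]
  have hsum : ∀ a b u : U, (∑ k ∈ Finset.range q,
      insertSum (Polynomial.C a + X * Polynomial.C b) (Polynomial.C u) k).coeff 1 =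
        ∑ k ∈ Finset.range m, (insertSum₂ a b u k + insertSum₂ a u b k) := fun a b u => by
    rw [finsetSum_coeff, hm, Finset.sum_range_succ', insertSum,
      coeff_C_of_ne_zero one_ne_zero, add_zero]
    exact Finset.sum_congr rfl fun k _ => coeff_one_insertSum a b u k
  obtain ⟨m', hm'⟩ : ∃ m', m = m' + 1 := Nat.exists_eq_add_one.2 (by omega)
  have hxz : x * z ∈ B := B.mul_mem_left _ hz
  -- with base `0`, only the sums with exactly the two inserted factors survive
  have hfirst : ∑ k ∈ Finset.range m, (insertSum₂ 0 z (g y * x) k + insertSum₂ 0 (g y * x) z k) =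
      z * (g y * x) + g y * x * z := by
    rw [hm', Finset.sum_range_succ', Finset.sum_eq_zero fun k _ => by
      rw [insertSum₂_zero_succ, insertSum₂_zero_succ, add_zero], zero_add]
    rfl
  have hgxg : (z * (g y * x) + g y * x * z) * g y =
      z * ∑ k ∈ Finset.range q, insertSum y x k + ∑ k ∈ Finset.range q, insertSum y (x * z) k := by
    have h1 := mul_insertSum_add_insertSum_mul hB hy hz hx
    rw [← insertSum_mul_eq_insertSum_mul hB hy hx hz] at h1
    calc
      (z * (g y * x) + g y * x * z) * g y = z * (g y * x * g y) + g y * (x * z) * g y := by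
        simp only [add_mul, mul_assoc]
      _ = _ := by
        rw [hgeom y hy x hx, hgeom y hy _ hxz, mul_add, add_add_add_comm, h1, add_zero]
  rw [hp, coeff_sub, coeff_sub, coeff_mul_C, hsum, hsum, hfirst, hgxg,
    sum_insertSum₂_one_sub_mul, insertSum₂_add_swap hB hy hz hx hm.symm, ← hm, sub_zero, sub_self,
    sub_zero, coeff_add, coeff_X_mul, coeff_C_zero, coeff_C_of_ne_zero one_ne_zero, zero_add,
    neg_eq_zero] at hcoeff
  exact hcoeff

/-- The obstruction `P x y` to the missing relations is annihilated by the whole algebra. -/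
theorem insertSum_mul_eq_zero (hB : ∀ x ∈ B, x ^ (Fintype.card F + 1) = 0) {x y z : U}
    (hx : x ∈ B) (hy : y ∈ B) (hz : z ∈ B) : insertSum x y (Fintype.card F) * z = 0 := by
  rw [← insertSum_mul_eq_insertSum_mul hB hx hy hz, insertSum_swap hB hx (B.mul_mem_left _ hz),
    insertSum_mul_left_eq_zero hB hx hy hz, neg_zero]

end Exceptional

/-! ### Polarizations of the power map -/

section Polarization

variable {ι : Type*} {U : Type*} [Ring U]

/-- The multidegree of the word `f 0, f 1, …`: it counts how often each index occurs. -/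
noncomputable def multidegree {n : ℕ} (f : Fin n → ι) : ι →₀ ℕ :=
  ∑ k, Finsupp.single (f k) 1

theorem multidegree_apply [DecidableEq ι] {n : ℕ} (f : Fin n → ι) (i : ι) :
    multidegree f i = (Finset.univ.filter fun k => f k = i).card := by
  simp [multidegree, Finsupp.finsetSum_apply, Finsupp.single_apply]

theorem monomial_multidegree {R : Type*} [CommSemiring R] {n : ℕ} (f : Fin n → ι) :
    MvPolynomial.monomial (multidegree f) (1 : R) = ∏ k, MvPolynomial.X (f k) := by
  rw [multidegree, MvPolynomial.monomial_sum_one]; rfl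

theorem sum_smul_pow [Fintype ι] {R : Type*} [CommRing R] [Algebra R U] (t : ι → R) (a : ι → U)
    (n : ℕ) :
    (∑ i, t i • a i) ^ n =
      ∑ f : Fin n → ι, (∏ k, t (f k)) • (List.ofFn fun k => a (f k)).prod := by
  induction n with
  | zero => simp
  | succ n ih =>
    rw [← (Fin.consEquiv fun _ => ι).sum_comp, Fintype.sum_prod_type, pow_succ', ih,
      Finset.sum_mul_sum]
    refine Finset.sum_congr rfl fun i _ => Finset.sum_congr rfl fun f _ => ?_
    simp [Fin.consEquiv, Fin.prod_univ_succ, List.ofFn_succ, smul_smul, mul_comm]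

open Classical in
/-- The component of multidegree `α` of `(∑ i, a i) ^ n`: the sum of all products of `n` of the
`a i` in which each `a i` occurs `α i` times. -/
noncomputable def polarization [Fintype ι] (a : ι → U) (n : ℕ) (α : ι →₀ ℕ) : U :=
  ∑ f : Fin n → ι with multidegree f = α, (List.ofFn fun k => a (f k)).prod

/-- Inserting one factor `y` at each of the `m + 1` places of a power of `x`. -/
theorem sum_ofFn_update (x y : U) (m : ℕ) :
    ∑ k : Fin (m + 1), (List.ofFn (Function.update (fun _ => x) k y)).prod = insertSum x y m := by
  induction m with
  | zero => simp [insertSum]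
  | succ m ih =>
    rw [Fin.sum_univ_succ, insertSum_succ, ← ih, Finset.mul_sum, add_comm]
    congr 1
    · refine Finset.sum_congr rfl fun k _ => ?_
      rw [List.ofFn_succ, List.prod_cons, Function.update_of_ne (Fin.succ_ne_zero k).symm]
      congr 3
      ext l
      by_cases h : l = k <;> simp [h]
    · rw [List.ofFn_succ, List.prod_cons, Function.update_self]
      simp [List.ofFn_const, pow_succ']

theorem multidegree_update {i j : ι} {m : ℕ} (k : Fin (m + 1)) :
    multidegree (Function.update (fun _ => i) k j) =
      Finsupp.single j 1 + m • Finsupp.single i 1 := by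
  classical
  rw [multidegree, ← Finset.add_sum_erase _ _ (Finset.mem_univ k), Function.update_self]
  congr 1
  rw [Finset.sum_congr rfl fun l hl => by
    rw [Function.update_of_ne (Finset.ne_of_mem_erase hl)]]
  simp

/-- If one index occurs at least `m` times among `m + 1` then all words of that multidegree arise
from a constant word by changing one letter. -/
theorem polarization_of_le [Fintype ι] (a : ι → U) {m : ℕ} {α : ι →₀ ℕ} {i : ι} (hi : m ≤ α i) :
    polarization a (m + 1) α = 0 ∨ polarization a (m + 1) α = a i ^ (m + 1) ∨
      ∃ j, polarization a (m + 1) α = insertSum (a i) (a j) m := by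
  classical
  by_cases hex : ∃ f : Fin (m + 1) → ι, multidegree f = α
  swap
  · refine Or.inl (Finset.sum_eq_zero fun f hf => absurd ⟨f, (Finset.mem_filter.1 hf).2⟩ hex)
  right
  obtain ⟨f, hf⟩ := hex
  -- at most one letter of a word of multidegree `α` differs from `i`
  have hupd : ∀ f : Fin (m + 1) → ι, multidegree f = α → ∀ k, f k ≠ i →
      f = Function.update (fun _ => i) k (f k) := by
    intro f hf k hk
    have hcard : (Finset.univ.filter fun l => ¬ f l = i).card ≤ 1 := by
      have h1 : multidegree f i + (Finset.univ.filter fun l => ¬ f l = i).card = m + 1 := by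
        rw [multidegree_apply]
        exact (Finset.card_filter_add_card_filter_not _).trans (by simp)
      rw [hf] at h1
      omega
    ext l
    by_cases hl : l = k
    · subst hl; simp
    · rw [Function.update_of_ne hl]
      by_contra h
      exact hl (Finset.card_le_one.1 hcard l (by simpa using h) k (by simpa using hk))
  by_cases hconst : ∀ k, f k = i
  · left
    have hf' : f = fun _ => i := funext hconst
    rw [polarization, Finset.sum_eq_single f]
    · simp [hf', List.ofFn_const, pow_succ']
    · intro f' h' hne
      refine absurd ?_ hne
      rw [hf']
      ext k
      have h1 : multidegree f' i = m + 1 := by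
        rw [(Finset.mem_filter.1 h').2, ← hf, multidegree_apply, Finset.filter_true_of_mem]
        · simp
        · exact fun k _ => hconst k
      rw [multidegree_apply] at h1
      have h2 := (Finset.card_eq_iff_eq_univ _).1 (h1.trans (Fintype.card_fin _).symm)
      simpa using (h2.symm ▸ Finset.mem_univ k : k ∈ Finset.univ.filter fun k => f' k = i)
    · exact fun h => absurd (by simpa using hf) h
  · push Not at hconst
    obtain ⟨k₀, hk₀⟩ := hconst
    refine Or.inr ⟨f k₀, ?_⟩
    have hα : α = Finsupp.single (f k₀) 1 + m • Finsupp.single i 1 := by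
      rw [← multidegree_update k₀, ← hupd f hf k₀ hk₀, hf]
    rw [← sum_ofFn_update, polarization]
    symm
    refine Finset.sum_bij (fun k _ => Function.update (fun _ => i) k (f k₀)) ?_ ?_ ?_ ?_
    · intro k _
      simp [multidegree_update, hα]
    · intro k _ k' _ h
      by_contra hne
      have := congrFun h k
      rw [Function.update_self, Function.update_of_ne hne] at this
      exact hk₀ this
    · intro f' hf'
      have hf'' := (Finset.mem_filter.1 hf').2
      have h1 : 0 < multidegree f' (f k₀) := by rw [hf'', hα]; simp
      rw [multidegree_apply, Finset.card_pos] at h1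
      obtain ⟨k, hk⟩ := h1
      have hk' : f' k = f k₀ := by simpa using hk
      exact ⟨k, Finset.mem_univ _, by rw [hupd f' hf'' k (by rwa [hk']), hk']⟩
    · intro k _
      congr 2
      ext l
      by_cases h : l = k <;> simp [h]

variable {K : Type*} [Field K] [Algebra K U]

/-- For a linear functional `φ`, the polynomial in the variables `t i` whose value at `t` is
`φ ((∑ i, t i • a i) ^ n * c)`. -/
noncomputable def powerPolynomial [Fintype ι] (φ : Module.Dual K U) (a : ι → U) (n : ℕ) (c : U) :
    MvPolynomial ι K :=
  ∑ f : Fin n → ι,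
    MvPolynomial.monomial (multidegree f) (φ ((List.ofFn fun k => a (f k)).prod * c))

theorem coeff_powerPolynomial [Fintype ι] (φ : Module.Dual K U) (a : ι → U) (n : ℕ) (c : U)
    (α : ι →₀ ℕ) : (powerPolynomial φ a n c).coeff α = φ (polarization a n α * c) := by
  classical
  rw [powerPolynomial, MvPolynomial.coeff_sum, polarization, Finset.sum_mul, map_sum,
    Finset.sum_filter]
  refine Finset.sum_congr (by congr) fun f _ => ?_
  rw [MvPolynomial.coeff_monomial]

theorem eval_powerPolynomial [Fintype ι] (φ : Module.Dual K U) (a : ι → U) (n : ℕ) (c : U)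
    (t : ι → K) : (powerPolynomial φ a n c).eval t = φ ((∑ i, t i • a i) ^ n * c) := by
  rw [powerPolynomial, sum_smul_pow, Finset.sum_mul, map_sum, map_sum]
  refine Finset.sum_congr rfl fun f _ => ?_
  rw [← mul_one (φ _), ← MvPolynomial.C_mul_monomial, monomial_multidegree, smul_mul_assoc,
    map_smul, map_mul, MvPolynomial.eval_C, map_prod]
  simp [mul_comm]

theorem polarization_mul_eq_zero [Fintype ι] {a : ι → U} {n : ℕ} {c : U}
    (h : ∀ φ : Module.Dual K U, powerPolynomial φ a n c = 0) (α : ι →₀ ℕ) :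
    polarization a n α * c = 0 := by
  rw [← Module.forall_dual_apply_eq_zero_iff K]
  intro φ
  rw [← coeff_powerPolynomial, h, MvPolynomial.coeff_zero]

theorem polarization_mul_eq_zero_of_infinite [Infinite K] {B : Ideal U} {n : ℕ}
    (hB : ∀ x ∈ B, x ^ n = 0) [Fintype ι] {a : ι → U} (ha : ∀ i, a i ∈ B) (α : ι →₀ ℕ) (c : U) :
    polarization a n α * c = 0 := by
  refine polarization_mul_eq_zero (K := K) (fun φ => MvPolynomial.funext fun t => ?_) α
  rw [eval_powerPolynomial, hB, zero_mul, map_zero, map_zero]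
  exact B.sum_mem fun i _ => B.smul_of_tower_mem (t i) (ha i)

/-- Over a field with `q` elements the polynomial in the `t i` vanishes at all points. Its
monomials of degree at least `q` in one variable have the coefficients `φ (a ^ (q + 1) * c) = 0`
and `φ (P a b * c) = 0`, so all its partial degrees are less than `q` and it is zero. -/
theorem polarization_mul_eq_zero_of_finite [Fintype K] {B : Ideal U} [B.IsTwoSided]
    (hB : ∀ x ∈ B, x ^ (Fintype.card K + 1) = 0) [Fintype ι] {a : ι → U} (ha : ∀ i, a i ∈ B)
    (α : ι →₀ ℕ) {c : U} (hc : c ∈ B) : polarization a (Fintype.card K + 1) α * c = 0 := by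
  refine polarization_mul_eq_zero (K := K) (fun φ => ?_) α
  refine MvPolynomial.eq_zero_of_eval_zero_at_prod_finset _ (fun _ => Finset.univ)
    (fun i => ?_) fun t _ => ?_
  · rw [Finset.card_univ, MvPolynomial.degreeOf_lt_iff Fintype.card_pos]
    intro α hα
    by_contra! hle
    refine MvPolynomial.mem_support_iff.1 hα ?_
    rw [coeff_powerPolynomial]
    rcases polarization_of_le a hle with h | h | ⟨j, h⟩
    · rw [h, zero_mul, map_zero]
    · rw [h, hB _ (ha i), zero_mul, map_zero]
    · rw [h, insertSum_mul_eq_zero hB (ha i) (ha j) hc, map_zero]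
  · rw [eval_powerPolynomial, hB, zero_mul, map_zero]
    exact B.sum_mem fun i _ => B.smul_of_tower_mem (t i) (ha i)

end Polarization

/-! ### Change of the base field -/

open scoped TensorProduct

theorem map_listProd {M U : Type*} [Mul M] [Monoid U] {Φ : Type*} [FunLike Φ M U]
    [MulHomClass Φ M U] (f : Φ) (a : M) (l : List M) :
    f (listProd a l) = f a * (l.map f).prod := by
  induction l generalizing a with
  | nil => simp [listProd]
  | cons b l ih =>
    have : listProd a (b :: l) = listProd (a * b) l := rfl
    rw [this, ih, map_mul, List.map_cons, List.prod_cons, mul_assoc]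

theorem map_power {M U : Type*} [Mul M] [Monoid U] {Φ : Type*} [FunLike Φ M U]
    [MulHomClass Φ M U] (f : Φ) (a : M) {n : ℕ} (hn : n ≠ 0) : f (power a n) = f a ^ n := by
  rw [power, map_listProd, List.map_replicate, List.prod_replicate, mul_pow_sub_one hn]

theorem lift_mk {α U : Type*} [Monoid U] (e : α → U) (i : α) (l : List α) :
    FreeSemigroup.lift e ⟨i, l⟩ = ((i :: l).map e).prod := by
  induction l generalizing i with
  | nil => rw [List.map_singleton, List.prod_singleton]; exact FreeSemigroup.lift_of e i
  | cons j l ih =>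
    have : (⟨i, j :: l⟩ : FreeSemigroup α) = FreeSemigroup.of i * ⟨j, l⟩ := rfl
    rw [this, map_mul, ih, FreeSemigroup.lift_of, List.map_cons (l := j :: l), List.prod_cons]

theorem lift_mem {α U : Type*} [Ring U] {B : Ideal U} {e : α → U} (he : ∀ i, e i ∈ B)
    (g : FreeSemigroup α) : FreeSemigroup.lift e g ∈ B := by
  induction g using FreeSemigroup.recOnMul with
  | ih1 i => rw [FreeSemigroup.lift_of]; exact he i
  | ih2 i g _ ih => rw [map_mul]; exact B.mul_mem_left _ ih

section Transfer

variable {k : Type*} [Field k] {K : Type u} [Field K] [Algebra k K] {U : Type*} [Ring U]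
  [Algebra k U] {d : ℕ}

/-- The homomorphism from the free algebra over `K` to `K ⊗ U` that sends the letter `i` to
`1 ⊗ e i`. -/
noncomputable def liftTensor (k : Type*) [Field k] (K : Type u) [Field K] [Algebra k K]
    [Algebra k U] (e : Fin d → U) : FreeAlg K d →ₙₐ[K] K ⊗[k] U :=
  MonoidAlgebra.liftMagma K
    (((Algebra.TensorProduct.includeRight : U →ₐ[k] K ⊗[k] U) : U →ₙ* K ⊗[k] U).comp
      (FreeSemigroup.lift e))

theorem liftTensor_apply (e : Fin d → U) (x : FreeAlg K d) :
    liftTensor k K e x =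
      ∑ g : x.coeff.support, x.coeff g • ((1 : K) ⊗ₜ[k] FreeSemigroup.lift e g.1) := by
  rw [Finset.sum_coe_sort x.coeff.support
    fun g => x.coeff g • ((1 : K) ⊗ₜ[k] FreeSemigroup.lift e g)]
  rfl

theorem liftTensor_single (e : Fin d → U) (g : FreeSemigroup (Fin d)) :
    liftTensor k K e (MonoidAlgebra.single g 1) = (1 : K) ⊗ₜ[k] FreeSemigroup.lift e g := by
  simp [liftTensor]

theorem pow_mul_tmul_eq_zero {ι : Type*} [Fintype ι] {a : ι → U} {n : ℕ} {c : U}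
    (h : ∀ α, polarization a n α * c = 0) (t : ι → K) :
    (∑ i, t i • ((1 : K) ⊗ₜ[k] a i)) ^ n * ((1 : K) ⊗ₜ[k] c) = 0 := by
  classical
  rw [sum_smul_pow, Finset.sum_mul,
    ← Finset.sum_fiberwise_of_maps_to (g := multidegree) (t := Finset.univ.image multidegree)
      fun f hf => Finset.mem_image_of_mem _ hf]
  refine Finset.sum_eq_zero fun α _ => ?_
  have hterm : ∀ f ∈ Finset.univ.filter fun f : Fin n → ι => multidegree f = α,
      ((∏ k, t (f k)) • (List.ofFn fun j => (1 : K) ⊗ₜ[k] a (f j)).prod) * ((1 : K) ⊗ₜ[k] c) =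
        (MvPolynomial.eval t (MvPolynomial.monomial α 1)) •
          (Algebra.TensorProduct.includeRight : U →ₐ[k] K ⊗[k] U)
            ((List.ofFn fun j => a (f j)).prod * c) := by
    intro f hf
    rw [← (Finset.mem_filter.1 hf).2, monomial_multidegree, map_prod, smul_mul_assoc, map_mul,
      map_list_prod, List.map_ofFn]
    simp only [MvPolynomial.eval_X]
    rfl
  rw [Finset.sum_congr rfl hterm, ← Finset.smul_sum, ← map_sum, ← Finset.sum_mul]
  have := h α
  rw [polarization] at this
  convert smul_zero _
  rw [← map_zero (Algebra.TensorProduct.includeRight : U →ₐ[k] K ⊗[k] U)]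
  congr 1

/-- If all polarizations of `n`-th powers of elements of `B` annihilate `J`, then `n`-th powers of
elements of `K ⊗ B` annihilate `1 ⊗ J`, over any extension `K` of the base field. So a word that
lies in the relation ideal over `K` annihilates `J` when evaluated in `U`. -/
theorem lift_mul_eq_zero (k : Type*) [Field k] [Algebra k K] [Algebra k U] {B J : Ideal U}
    {e : Fin d → U} (he : ∀ i, e i ∈ B) {n : ℕ} (hn : n ≠ 0)
    (h : ∀ (ι : Type) [Fintype ι] (a : ι → U), (∀ i, a i ∈ B) →
      ∀ α, ∀ c ∈ J, polarization a n α * c = 0)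
    {g : FreeSemigroup (Fin d)} (hg : MonoidAlgebra.single g 1 ∈ relationSpace K n d) {c : U}
    (hc : c ∈ J) : FreeSemigroup.lift e g * c = 0 := by
  let I : Submodule K (FreeAlg K d) :=
    { carrier := {f | ∀ c ∈ J, liftTensor k K e f * ((1 : K) ⊗ₜ[k] c) = 0}
      add_mem' := fun hx hy c hc => by rw [map_add, add_mul, hx c hc, hy c hc, add_zero]
      zero_mem' := fun c _ => by rw [map_zero, zero_mul]
      smul_mem' := fun t x hx c hc => by rw [map_smul, smul_mul_assoc, hx c hc, smul_zero] }
  have hI : IsIdeal I := by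
    intro a f hf
    refine ⟨fun c hc => ?_, fun c hc => ?_⟩
    · rw [map_mul, mul_assoc, hf c hc, mul_zero]
    · rw [map_mul, mul_assoc, liftTensor_apply e a, Finset.sum_mul, Finset.mul_sum]
      refine Finset.sum_eq_zero fun g _ => ?_
      rw [smul_mul_assoc, mul_smul_comm, Algebra.TensorProduct.tmul_mul_tmul, one_mul,
        hf _ (J.mul_mem_left _ hc), smul_zero]
  have hpow : ∀ x : FreeAlg K d, power x n ∈ I := by
    intro x c hc
    rw [map_power _ _ hn, liftTensor_apply]
    exact pow_mul_tmul_eq_zero (fun α => h _ _ (fun i => lift_mem he _) α c hc) _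
  have hle : relationSpace K n d ≤ I := sInf_le ⟨hI, hpow⟩
  have h0 := hle hg c hc
  rw [liftTensor_single, Algebra.TensorProduct.tmul_mul_tmul, one_mul] at h0
  have hinj := Algebra.TensorProduct.includeRight_injective (R := k) (A := K) (B := U)
    (algebraMap k K).injective
  exact hinj (h0.trans (map_zero _).symm)

end Transfer

section Quotient

variable (K : Type u) [Field K] (n d : ℕ)

theorem coe_eq_coe_iff (x y : FreeAlg K d) :
    (x : N K n d) = y ↔ x - y ∈ relationSpace K n d := by
  rw [RingCon.eq, TwoSidedIdeal.rel_iff, relationIdeal, TwoSidedIdeal.mem_mk']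
  rfl

noncomputable instance : SMul K (N K n d) where
  smul t := Quotient.map (t • ·) fun x y h => by
    have h' := (coe_eq_coe_iff K n d x y).1 (Quotient.sound h)
    refine Quotient.exact ((coe_eq_coe_iff K n d (t • x) (t • y)).2 ?_)
    rw [← smul_sub]
    exact (relationSpace K n d).smul_mem t h'

theorem coe_surjective : Function.Surjective fun x : FreeAlg K d => (x : N K n d) :=
  Quotient.mk_surjective

noncomputable instance : Module K (N K n d) :=
  Function.Surjective.module K
    ({ toFun := fun x : FreeAlg K d => (x : N K n d), map_zero' := rfl,
       map_add' := fun _ _ => rfl } : FreeAlg K d →+ N K n d) (coe_surjective K n d) fun _ _ => rfl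

instance : IsScalarTower K (N K n d) (N K n d) where
  smul_assoc t x y := by
    obtain ⟨x, rfl⟩ := coe_surjective K n d x
    obtain ⟨y, rfl⟩ := coe_surjective K n d y
    exact congrArg _ (smul_mul_assoc t x y)

instance : SMulCommClass K (N K n d) (N K n d) where
  smul_comm t x y := by
    obtain ⟨x, rfl⟩ := coe_surjective K n d x
    obtain ⟨y, rfl⟩ := coe_surjective K n d y
    exact congrArg _ (mul_smul_comm t x y).symm

/-- The quotient map from the free algebra to `N`, followed by the embedding of `N` into its
unitization. -/
noncomputable def toUnitization : FreeAlg K d →ₙₐ[K] Unitization K (N K n d) :=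
  (Unitization.inrNonUnitalAlgHom K (N K n d)).comp
    { toFun := fun x => x, map_smul' := fun _ _ => rfl, map_zero' := rfl, map_add' := fun _ _ => rfl
      map_mul' := fun _ _ => rfl }

theorem toUnitization_apply (x : FreeAlg K d) :
    toUnitization K n d x = Unitization.inr (x : N K n d) := rfl

variable {K n d}

theorem toUnitization_eq_zero_iff {x : FreeAlg K d} :
    toUnitization K n d x = 0 ↔ x ∈ relationSpace K n d := by
  rw [toUnitization_apply, ← Unitization.inr_zero K, Unitization.inr_injective.eq_iff]
  simpa using coe_eq_coe_iff K n d x 0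

variable (K n d) in
/-- The copy of `N` inside its unitization, as the kernel of the augmentation. -/
noncomputable def augmentation : Ideal (Unitization K (N K n d)) :=
  RingHom.ker (Unitization.fstHom K (N K n d))

instance : (augmentation K n d).IsTwoSided := by unfold augmentation; infer_instance

theorem inr_mem_augmentation (x : N K n d) : Unitization.inr x ∈ augmentation K n d :=
  Unitization.fst_inr K x

theorem exists_toUnitization_eq {u : Unitization K (N K n d)} (hu : u ∈ augmentation K n d) :
    ∃ x, toUnitization K n d x = u := by
  obtain ⟨x, hx⟩ := coe_surjective K n d u.snd
  refine ⟨x, Unitization.ext ?_ ?_⟩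
  · exact (Unitization.fst_inr K _).trans (show u.fst = 0 from hu).symm
  · exact (Unitization.snd_inr K _).trans hx

theorem pow_eq_zero_of_mem_augmentation (hn : n ≠ 0) :
    ∀ u ∈ augmentation K n d, u ^ n = 0 := by
  intro u hu
  obtain ⟨x, rfl⟩ := exists_toUnitization_eq hu
  rw [← map_power _ _ hn, toUnitization_eq_zero_iff, relationSpace, Submodule.mem_sInf]
  exact fun I hI => hI.2 x

variable (K n d) in
/-- The image of the letter `i` in the unitization of `N`. -/
noncomputable def letter (i : Fin d) : Unitization K (N K n d) :=
  toUnitization K n d (MonoidAlgebra.single (FreeSemigroup.of i) 1)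

theorem letter_mem (i : Fin d) : letter K n d i ∈ augmentation K n d := inr_mem_augmentation _

theorem toUnitization_single (g : FreeSemigroup (Fin d)) :
    toUnitization K n d (MonoidAlgebra.single g 1) = FreeSemigroup.lift (letter K n d) g := by
  induction g using FreeSemigroup.recOnMul with
  | ih1 i => rw [FreeSemigroup.lift_of]; rfl
  | ih2 i g _ ih =>
    rw [map_mul, FreeSemigroup.lift_of, ← ih, letter, ← map_mul, MonoidAlgebra.single_mul_single,
      one_mul]

theorem toUnitization_single_eq_mul (g : FreeSemigroup (Fin d)) (t : K) :
    toUnitization K n d (MonoidAlgebra.single g t) =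
      algebraMap K _ t * FreeSemigroup.lift (letter K n d) g := by
  have h1 : (MonoidAlgebra.single g t : FreeAlg K d) = t • MonoidAlgebra.single g 1 := by simp
  rw [h1, map_smul, toUnitization_single]
  exact Algebra.smul_def (A := Unitization K (N K n d)) t _

theorem single_mem_relationSpace_iff {g : FreeSemigroup (Fin d)} :
    MonoidAlgebra.single g 1 ∈ relationSpace K n d ↔ FreeSemigroup.lift (letter K n d) g = 0 := by
  rw [← toUnitization_single, toUnitization_eq_zero_iff]

theorem prod_map_letter_mul_prod_eq_zero {c : ℕ}
    (h : ∀ l : List (Fin d), l.length = c → (l.map (letter K n d)).prod = 0) :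
    ∀ (l : List (Unitization K (N K n d))) (m : List (Fin d)), (∀ u ∈ l, u ∈ augmentation K n d) →
      c ≤ m.length + l.length → (m.map (letter K n d)).prod * l.prod = 0 := by
  intro l
  induction l with
  | nil =>
    intro m _ hm
    rw [← List.take_append_drop c m, List.map_append, List.prod_append, h, zero_mul, zero_mul]
    simpa using hm
  | cons u l ih =>
    intro m hu hm
    obtain ⟨x, rfl⟩ := exists_toUnitization_eq (hu u List.mem_cons_self)
    rw [List.prod_cons]
    induction x using MonoidAlgebra.induction_linear with
    | zero => rw [map_zero, zero_mul, mul_zero]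
    | add x y hx hy =>
      rw [map_add, add_mul, mul_add, hx, hy, add_zero]
      · exact List.forall_mem_cons.2 ⟨inr_mem_augmentation _, (List.forall_mem_cons.1 hu).2⟩
      · simpa using hm
      · exact List.forall_mem_cons.2 ⟨inr_mem_augmentation _, (List.forall_mem_cons.1 hu).2⟩
      · simpa using hm
    | single g t =>
      obtain ⟨i, w⟩ := g
      rw [toUnitization_single_eq_mul, mul_assoc, Algebra.left_comm, lift_mk,
        ← mul_assoc (List.prod _), ← List.prod_append, ← List.map_append,
        ih _ (List.forall_mem_cons.1 hu).2, mul_zero]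
      simp only [List.length_append, List.length_cons] at hm ⊢
      omega

/-- Nilpotency can be tested on words in the letters, since these span `N`. -/
theorem mem_nilpotencySet_iff {c : ℕ} (hc : 0 < c) :
    c ∈ nilpotencySet K n d ↔
      ∀ l : List (Fin d), l.length = c → (l.map (letter K n d)).prod = 0 := by
  have hinr : ∀ (a : N K n d) (l : List (N K n d)),
      (Unitization.inr (listProd a l) : Unitization K (N K n d)) =
        ((a :: l).map Unitization.inr).prod := fun a l =>
    map_listProd (Unitization.inrNonUnitalAlgHom K (N K n d)) a l
  constructor
  · rintro ⟨-, h⟩ l hl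
    match l, hl with
    | [], hl => exact absurd hl hc.ne
    | i :: l, hl =>
      have h1 := hinr (MonoidAlgebra.single (FreeSemigroup.of i) (1 : K) : FreeAlg K d)
        (l.map fun j =>
          ((MonoidAlgebra.single (FreeSemigroup.of j) (1 : K) : FreeAlg K d) : N K n d))
      rw [h _ _ (by simpa using hl), Unitization.inr_zero, List.map_cons, List.map_map] at h1
      exact h1.symm
  · refine fun h => ⟨hc, fun a l hl => ?_⟩
    refine Unitization.inr_injective (R := K) ?_
    rw [hinr, Unitization.inr_zero]
    have := prod_map_letter_mul_prod_eq_zero h ((a :: l).map Unitization.inr) []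
      (fun u hu => by
        obtain ⟨x, -, rfl⟩ := List.mem_map.1 hu
        exact inr_mem_augmentation x) (by simp [hl])
    simpa using this

theorem nilpotencySet_nonempty (hn : n ≠ 0) : (nilpotencySet K n d).Nonempty := by
  obtain ⟨c, hc⟩ := exists_forall_prod_map_eq_zero (augmentation K n d)
    (pow_eq_zero_of_mem_augmentation hn) (letter K n d) letter_mem
  refine ⟨c + 1, (mem_nilpotencySet_iff c.succ_pos).2 fun l hl => ?_⟩
  rw [← List.take_append_drop c l, List.map_append, List.prod_append, hc, zero_mul]
  simp [hl]

/-- The words of length `c` vanish in `N` over `K`; under a condition on polarizations they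
annihilate `J` in the algebra over `L`, where `K` and `L` need only have the same prime field. -/
theorem prod_map_letter_mul_eq_zero {K : Type u} [Field K] {L : Type v} [Field L]
    (hchar : ringChar L = ringChar K) (hp : ringChar K ≠ 0) (hn : n ≠ 0)
    {J : Ideal (Unitization L (N L n d))}
    (h : ∀ (ι : Type) [Fintype ι] (a : ι → Unitization L (N L n d)),
      (∀ i, a i ∈ augmentation L n d) → ∀ α, ∀ c ∈ J, polarization a n α * c = 0)
    {c : ℕ} (hc : c ∈ nilpotencySet K n d) {l : List (Fin d)} (hl : l.length = c)
    {u : Unitization L (N L n d)} (hu : u ∈ J) : (l.map (letter L n d)).prod * u = 0 := by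
  have hprime : Fact (ringChar K).Prime := ⟨(CharP.char_is_prime_or_zero K _).resolve_right hp⟩
  have hL : CharP L (ringChar K) := hchar ▸ ringChar.charP L
  have hU : CharP (Unitization L (N L n d)) (ringChar K) :=
    charP_of_injective_algebraMap (algebraMap L _).injective _
  let := ZMod.algebra K (ringChar K)
  let := ZMod.algebra (Unitization L (N L n d)) (ringChar K)
  match l, hl with
  | [], hl => exact absurd hl hc.1.ne
  | i :: l, hl =>
    rw [← lift_mk]
    refine lift_mul_eq_zero (K := K) (ZMod (ringChar K)) letter_mem hn h ?_ hu
    rw [single_mem_relationSpace_iff, lift_mk]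
    exact (mem_nilpotencySet_iff hc.1).1 hc _ hl

end Quotient

end NilAlg

theorem theorem3 (n d : ℕ) (hd : 2 ≤ d)
    (F : Type u) [Field F] [Fintype F] (hF : Fintype.card F + 1 = n)
    (L : Type v) [Field L] [Infinite L] (hchar : ringChar L = ringChar F) :
    -- the minima that define the two nilpotency degrees exist
    (NilAlg.nilpotencySet L n d).Nonempty ∧ (NilAlg.nilpotencySet F n d).Nonempty ∧
      NilAlg.C L n d ≤ NilAlg.C F n d ∧ NilAlg.C F n d ≤ NilAlg.C L n d + 1 := by
  open NilAlg in
  have hn : n ≠ 0 := by omega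
  have hp : ringChar F ≠ 0 := CharP.ringChar_ne_zero_of_finite F
  have hneL : (nilpotencySet L n d).Nonempty := nilpotencySet_nonempty hn
  have hneF : (nilpotencySet F n d).Nonempty := nilpotencySet_nonempty hn
  have hCL : C L n d ∈ nilpotencySet L n d := Nat.sInf_mem hneL
  have hCF : C F n d ∈ nilpotencySet F n d := Nat.sInf_mem hneF
  refine ⟨hneL, hneF, Nat.sInf_le ?_, Nat.sInf_le ?_⟩
  · refine (mem_nilpotencySet_iff hCF.1).2 fun l hl => ?_
    rw [← mul_one (List.prod _)]
    refine prod_map_letter_mul_eq_zero (J := ⊤) hchar hp hn (fun ι _ a ha α c _ => ?_) hCF hl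
      Submodule.mem_top
    exact polarization_mul_eq_zero_of_infinite (K := L) (pow_eq_zero_of_mem_augmentation hn) ha α c
  · refine (mem_nilpotencySet_iff (Nat.succ_pos _)).2 fun l hl => ?_
    rw [← List.take_append_drop (C L n d) l, List.map_append, List.prod_append]
    refine prod_map_letter_mul_eq_zero (J := augmentation F n d) hchar.symm (hchar ▸ hp) hn
      (fun ι _ a ha α c hc => ?_) hCL (by simp [hl]) ?_
    · have := pow_eq_zero_of_mem_augmentation (K := F) (d := d) hn
      subst hF
      exact polarization_mul_eq_zero_of_finite this ha α hc
    · obtain ⟨i, hi⟩ := List.length_eq_one_iff.1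
        (show (l.drop (C L n d)).length = 1 by simp [hl])
      rw [hi]
      simpa using letter_mem i
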